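/- Let $(R,\mathfrak m)$ be a (commutative) Noetherian local ring and let $J\subset R$ be a fixed $\mathfrak m$-primary ideal. Then for every real number $\varepsilon>0$ there exists an integer $N>0$ such that for every $\mathfrak m$-primary ideal $I\subset R$ with $\ell(R/I)>N$, $$\frac{\ell\big((I:J)/I\big)}{\ell(R/I)}<\varepsilon .$$ Here an ideal is called $\mathfrak m$-primary if it is primary with radical $\mathfrak m$, $(I:J)=\{r\in R : rJ\subseteq I\}$, and $\ell$ denotes length as an $R$-module (both lengths above are finite). -/

import Mathlib

/-- An ideal of a local ring `(R, 𝔪)` is `𝔪`-primary if it is a primary ideal whose radical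
is the maximal ideal `𝔪`. -/
def IsMaximalPrimary {R : Type*} [CommRing R] [IsLocalRing R] (I : Ideal R) : Prop :=
  I.IsPrimary ∧ I.radical = IsLocalRing.maximalIdeal R

/-- The colength `ℓ(R/I)`, the length of `R/I` as an `R`-module (possibly `⊤`). -/
noncomputable def colength {R : Type*} [CommRing R] (I : Ideal R) : ℕ∞ :=
  Module.length R (R ⧸ I)

/-- The length `ℓ((I : J)/I)` of the `R`-module `(I : J)/I`, where
`(I : J) = {r ∈ R | r J ⊆ I}` and `I` is viewed as a submodule of `(I : J)`. -/
noncomputable def colonLength {R : Type*} [CommRing R] (I J : Ideal R) : ℕ∞ :=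
  Module.length R (↥(I.colon (J : Set R)) ⧸ Submodule.submoduleOf I (I.colon (J : Set R)))

/-! Let `J` be generated by `k` elements `x`, and let `Q` be the ideal generated by the powers `x ^
p`. Each `x` kills `(I : J)/I`. A submodule `K` of `M` killed by `x` and contained in `x ^ p M` lies
in the kernel of `x` on every `x ^ j M` with `j < p`, so `p * ℓ(K) ≤ ℓ(M)`. Adding the `x ^ p` to
`I` one generator at a time therefore costs at most `ℓ(R/I) / p` each, and what survives lies in
`R/(I + Q)`, of length at most `d = ℓ(R/Q)`, a constant independent of `I`. Hence the ratio is at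
most `k / p + d / ℓ(R/I)`; fix `p` large first, then take `ℓ(R/I)` large. -/

lemma Module.length_eq_length_ker_add_length_range {R M P : Type*} [Ring R] [AddCommGroup M]
    [Module R M] [AddCommGroup P] [Module R P] (f : M →ₗ[R] P) :
    Module.length R M = Module.length R (LinearMap.ker f) + Module.length R (LinearMap.range f) := by
  refine Module.length_eq_add_of_exact (LinearMap.ker f).subtype f.rangeRestrict
    (Submodule.subtype_injective _) f.surjective_rangeRestrict fun x => ⟨fun hx => ?_, ?_⟩
  · exact ⟨⟨x, congrArg Subtype.val hx⟩, rfl⟩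
  · rintro ⟨y, rfl⟩
    exact Subtype.ext y.2

/-- Elements killed by an endomorphism `g` that are divisible by a high power of `g` are rare. -/
lemma mul_length_ker_inf_range_pow_le {R M : Type*} [Ring R] [AddCommGroup M] [Module R M]
    (g : Module.End R M) (p : ℕ) (K : Submodule R M) (hker : K ≤ LinearMap.ker g)
    (hrange : K ≤ LinearMap.range (g ^ p)) :
    p * Module.length R K ≤ Module.length R M := by
  -- Passing from `range (g ^ j)` to `range (g ^ (j + 1))` loses the length of the kernel of `g` on
  -- the former, which contains `K`.
  have key : ∀ j ≤ p, j * Module.length R K + Module.length R (LinearMap.range (g ^ j)) ≤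
      Module.length R M := by
    intro j
    induction j with
    | zero =>
      intro _
      simpa using Module.length_le_of_injective (LinearMap.range (g ^ 0)).subtype
        Subtype.val_injective
    | succ j ih =>
      intro hj
      refine le_trans ?_ (ih (by omega))
      have hKj : K ≤ LinearMap.range (g ^ j) := by
        intro v hv
        obtain ⟨m, rfl⟩ := hrange hv
        obtain ⟨i, rfl⟩ := Nat.exists_eq_add_of_le (show j ≤ p by omega)
        exact ⟨(g ^ i) m, by rw [pow_add]; rfl⟩
      let f : LinearMap.range (g ^ j) →ₗ[R] M := g.comp (LinearMap.range (g ^ j)).subtype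
      have hf : LinearMap.range (g ^ (j + 1)) = LinearMap.range f := by
        rw [LinearMap.range_comp, Submodule.range_subtype, pow_succ', Module.End.mul_eq_comp,
          LinearMap.range_comp]
      have h1 := Module.length_eq_length_ker_add_length_range f
      have h2 : Module.length R K ≤ Module.length R (LinearMap.ker f) :=
        Module.length_le_of_injective
          ((Submodule.inclusion hKj).codRestrict (LinearMap.ker f) fun x => hker x.2) fun a b hab =>
              Subtype.ext (congrArg
                (fun z : LinearMap.ker f => ((z : LinearMap.range (g ^ j)) : M)) hab)
      rw [hf, h1, Nat.cast_succ, add_mul, one_mul, add_assoc]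
      gcongr
  exact le_trans le_self_add (key p le_rfl)

/-- The effect on the length of `(V + N) / N` of enlarging `N` by `x ^ p M`, when `x V ⊆ N`. -/
lemma mul_length_map_mkQ_le {R M : Type*} [CommRing R] [AddCommGroup M] [Module R M]
    (p : ℕ) (x : R) (N V : Submodule R M) (h : ∀ v ∈ V, x • v ∈ N) :
    p * Module.length R (V.map N.mkQ) ≤ Module.length R (M ⧸ N) + p * Module.length R
      (V.map (N ⊔ LinearMap.range (LinearMap.lsmul R M (x ^ p))).mkQ) := by
  set N' := N ⊔ LinearMap.range (LinearMap.lsmul R M (x ^ p))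
  let q : M ⧸ N →ₗ[R] M ⧸ N' := Submodule.factor le_sup_left
  let f : V.map N.mkQ →ₗ[R] M ⧸ N' := q.comp (V.map N.mkQ).subtype
  have hf : LinearMap.range f = V.map N'.mkQ := by
    rw [LinearMap.range_comp, Submodule.range_subtype, ← Submodule.map_comp]
    rfl
  have h1 := Module.length_eq_length_ker_add_length_range f
  let K := (LinearMap.ker f).map (V.map N.mkQ).subtype
  have h2 : Module.length R (LinearMap.ker f) = Module.length R K :=
    (Submodule.equivMapOfInjective _ Subtype.val_injective _).length_eq
  have h3 : p * Module.length R K ≤ Module.length R (M ⧸ N) := by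
    apply mul_length_ker_inf_range_pow_le (Algebra.lsmul R R (M ⧸ N) x) p K
    · rintro _ ⟨⟨_, v, hv, rfl⟩, -, rfl⟩
      simpa [← Submodule.Quotient.mk_smul] using h v hv
    · rintro _ ⟨⟨_, v, hv, rfl⟩, hk, rfl⟩
      -- A class dying modulo `N'` is represented by some `x ^ p • m`, so it is divisible by `x ^ p`
      -- in `M ⧸ N`.
      have hv' : v ∈ N' := by
        have : N'.mkQ v = 0 := hk
        simpa using this
      obtain ⟨a, ha, _, ⟨m, rfl⟩, rfl⟩ := Submodule.mem_sup.1 hv'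
      refine ⟨N.mkQ m, ?_⟩
      rw [← map_pow]
      have ha' : N.mkQ a = 0 := by simpa using ha
      simp only [Algebra.lsmul_coe, Submodule.subtype_apply, map_add, ha', zero_add,
        LinearMap.lsmul_apply, map_smul]
  rw [h1, h2, hf, mul_add]
  gcongr

/-- Iterates `mul_length_map_mkQ_le` over the generators. Enlarging `N` keeps the condition `x • v ∈
N` and only shrinks `M ⧸ N`, so each step costs at most the original length. -/
lemma mul_length_map_mkQ_le_card_mul {R M : Type*} [CommRing R] [AddCommGroup M] [Module R M]
    (p : ℕ) (s : Finset R) (N V : Submodule R M) (h : ∀ x ∈ s, ∀ v ∈ V, x • v ∈ N) :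
    p * Module.length R (V.map N.mkQ) ≤ s.card * Module.length R (M ⧸ N) + p * Module.length R
      (M ⧸ N ⊔ s.sup fun x => LinearMap.range (LinearMap.lsmul R M (x ^ p))) := by
  classical
  induction s using Finset.induction_on generalizing N with
  | empty =>
    rw [Finset.card_empty, Nat.cast_zero, zero_mul, zero_add, Finset.sup_empty, sup_bot_eq]
    gcongr
    exact Module.length_le_of_injective (V.map N.mkQ).subtype Subtype.val_injective
  | insert x s hx ih =>
    have h1 := mul_length_map_mkQ_le p x N V (h x (Finset.mem_insert_self x s))
    have h2 := ih (N ⊔ LinearMap.range (LinearMap.lsmul R M (x ^ p)))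
      fun y hy v hv => Submodule.mem_sup_left (h y (Finset.mem_insert_of_mem hy) v hv)
    have h3 : Module.length R (M ⧸ N ⊔ LinearMap.range (LinearMap.lsmul R M (x ^ p))) ≤
        Module.length R (M ⧸ N) :=
      Module.length_le_of_surjective (Submodule.factor le_sup_left)
        (Submodule.factor_surjective le_sup_left)
    rw [Finset.card_insert_of_notMem hx, Finset.sup_insert, ← sup_assoc, Nat.cast_succ, add_mul,
      one_mul, add_comm _ (Module.length R (M ⧸ N)), add_assoc]
    refine h1.trans ?_
    gcongr
    refine h2.trans ?_
    gcongr

lemma length_quotient_ne_top_of_maximalIdeal_le_radical {R : Type*} [CommRing R] [IsLocalRing R]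
    [IsNoetherianRing R] (Q : Ideal R) (hQ : IsLocalRing.maximalIdeal R ≤ Q.radical) :
    Module.length R (R ⧸ Q) ≠ ⊤ := by
  by_cases htop : Q = ⊤
  · subst htop
    have : Subsingleton (R ⧸ (⊤ : Ideal R)) := Ideal.Quotient.subsingleton_iff.2 rfl
    simp [Module.length_eq_zero]
  have : Nontrivial (R ⧸ Q) := Ideal.Quotient.nontrivial_iff.2 htop
  have : IsLocalRing (R ⧸ Q) :=
    IsLocalRing.of_surjective' (Ideal.Quotient.mk Q) Ideal.Quotient.mk_surjective
  have : IsArtinianRing (R ⧸ Q) := by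
    rw [isArtinianRing_iff_isNilpotent_maximalIdeal]
    obtain ⟨n, hn⟩ := Ideal.exists_pow_le_of_le_radical_of_fg hQ
      (IsNoetherian.noetherian (IsLocalRing.maximalIdeal R))
    refine ⟨n, ?_⟩
    have hmap : IsLocalRing.maximalIdeal (R ⧸ Q) =
        (IsLocalRing.maximalIdeal R).map (Ideal.Quotient.mk Q) :=
      (IsLocalRing.map_maximalIdeal_of_surjective _ Ideal.Quotient.mk_surjective).symm
    rw [hmap, ← Ideal.map_pow, Ideal.zero_eq_bot, Ideal.map_eq_bot_iff_le_ker, Ideal.mk_ker]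
    exact hn
  rw [Module.length_eq_of_surjective (S := R) (R := R ⧸ Q) (M := R ⧸ Q)
    Ideal.Quotient.mk_surjective]
  exact Module.length_ne_top

lemma colonLength_le_length_map_mkQ {R : Type*} [CommRing R] (I J : Ideal R) :
    colonLength I J ≤ Module.length R (Submodule.map I.mkQ (I.colon (J : Set R))) := by
  set V := I.colon (J : Set R)
  let f : ↥V ⧸ Submodule.submoduleOf I V →ₗ[R] R ⧸ I :=
    Submodule.mapQ (Submodule.submoduleOf I V) I V.subtype le_rfl
  refine Module.length_le_of_injective (f.codRestrict (Submodule.map I.mkQ V) fun z => ?_) ?_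
  · obtain ⟨v, rfl⟩ := Submodule.mkQ_surjective _ z
    exact ⟨v, v.2, rfl⟩
  · rw [← LinearMap.ker_eq_bot, LinearMap.ker_codRestrict, LinearMap.ker_eq_bot']
    intro z hz
    obtain ⟨v, rfl⟩ := Submodule.mkQ_surjective _ z
    have hv : I.mkQ (v : R) = 0 := hz
    rw [Submodule.mkQ_apply, Submodule.Quotient.mk_eq_zero] at hv ⊢
    exact hv

theorem corollary3p6 {R : Type*} [CommRing R] [IsLocalRing R] [IsNoetherianRing R]
    (J : Ideal R) (hJ : IsMaximalPrimary J) (ε : ℝ) (hε : 0 < ε) :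
    ∃ N : ℕ, 0 < N ∧ ∀ I : Ideal R, IsMaximalPrimary I → (N : ℕ∞) < colength I →
      colength I ≠ ⊤ ∧ colonLength I J ≠ ⊤ ∧
        ((colonLength I J).toNat : ℝ) / ((colength I).toNat : ℝ) < ε := by
  obtain ⟨s, hs⟩ := IsNoetherian.noetherian J
  -- Makes `s.card / p < ε / 2`.
  obtain ⟨p, hp⟩ := exists_nat_gt (2 * s.card / ε)
  have hp0 : (0 : ℝ) < p := lt_of_le_of_lt (by positivity) hp
  let Q : Ideal R := s.sup fun x => LinearMap.range (LinearMap.lsmul R R (x ^ p))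
  have hQ : Module.length R (R ⧸ Q) ≠ ⊤ := by
    refine length_quotient_ne_top_of_maximalIdeal_le_radical Q ?_
    rw [← hJ.2, Ideal.radical_le_radical_iff, ← hs]
    refine Submodule.span_le.2 fun x hx => ⟨p, ?_⟩
    exact Finset.le_sup (f := fun x => LinearMap.range (LinearMap.lsmul R R (x ^ p))) hx
      ⟨1, by simp⟩
  obtain ⟨d, hd⟩ := ENat.ne_top_iff_exists.1 hQ
  -- Makes `d / ℓ(R/I) < ε / 2` once `ℓ(R/I) > N`.
  obtain ⟨N, hN⟩ := exists_nat_gt (2 * d / ε)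
  refine ⟨N + 1, N.succ_pos, fun I hI hlt => ?_⟩
  have hI' : colength I ≠ ⊤ := length_quotient_ne_top_of_maximalIdeal_le_radical I hI.2.ge
  have hle := colonLength_le_length_map_mkQ I J
  have hcolon : colonLength I J ≠ ⊤ := ne_top_of_le_ne_top hI' <| hle.trans <|
    Module.length_le_of_injective (Submodule.subtype _) (Submodule.subtype_injective _)
  refine ⟨hI', hcolon, ?_⟩
  have hmain : p * colonLength I J ≤ s.card * colength I + p * d := by
    have hkill : ∀ x ∈ s, ∀ v ∈ I.colon (J : Set R), x • v ∈ I := by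
      intro x hx v hv
      have hxJ : x ∈ J := hs ▸ Submodule.subset_span hx
      rw [smul_eq_mul, mul_comm]
      exact Submodule.mem_colon.1 hv x hxJ
    have hsup : Module.length R (R ⧸ I ⊔ Q) ≤ d := hd ▸
      Module.length_le_of_surjective (Submodule.factor le_sup_right)
        (Submodule.factor_surjective le_sup_right)
    calc (p : ℕ∞) * colonLength I J ≤ p * Module.length R (Submodule.map I.mkQ (I.colon (J : Set R))) := by
          gcongr
      _ ≤ s.card * colength I + p * Module.length R (R ⧸ I ⊔ Q) :=
          mul_length_map_mkQ_le_card_mul p s I _ hkill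
      _ ≤ _ := by gcongr
  obtain ⟨l, hl⟩ := ENat.ne_top_iff_exists.1 hI'
  obtain ⟨c, hc⟩ := ENat.ne_top_iff_exists.1 hcolon
  rw [← hl, ← hc] at hmain
  rw [← hl] at hlt
  rw [← hl, ← hc, ENat.toNat_natCast, ENat.toNat_natCast]
  have hmain' : (p : ℝ) * c ≤ s.card * l + p * d := by exact_mod_cast hmain
  have hlt' : (N : ℝ) + 1 < l := by exact_mod_cast hlt
  have hN0 : (0 : ℝ) ≤ N := N.cast_nonneg
  have hl0 : (0 : ℝ) < l := by linarith
  rw [div_lt_iff₀ hε] at hp hN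
  rw [div_lt_iff₀ hl0]
  have h1 : (2 * s.card : ℝ) * l < p * ε * l := by gcongr
  have h2 : (p : ℝ) * (2 * d) < p * (l * ε) := by
    have h3 : (N : ℝ) * ε < l * ε := mul_lt_mul_of_pos_right (by linarith) hε
    exact mul_lt_mul_of_pos_left (by linarith) hp0
  refine lt_of_mul_lt_mul_left (a := (p : ℝ)) ?_ hp0.le
  linarith
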